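/- Manifolds are smooth, finite-dimensional, Hausdorff and second countable. Let $\mathcal G\rightrightarrows M$ be a Lie groupoid with source $\alpha$ and target $\beta$, where $g\cdot h$ is defined when $\alpha(g)=\beta(h)$, let $\iota_M:M\hookrightarrow\mathcal G$ be the inclusion of the units, and let $A(\mathcal G)=\ker T\alpha|_{\iota_M(M)}$ be its Lie algebroid, with the bracket of right-invariant vector fields. A (smooth) bisection is a smooth map $\sigma:M\to\mathcal G$ such that $\alpha\circ\sigma=\mathrm{id}_M$ and $\beta\circ\sigma$ is a diffeomorphism of $M$; bisections form a group under $(\sigma\star\tau)(x)=\sigma(\beta(\tau(x)))\cdot\tau(x)$. The support $\operatorname{supp}\sigma$ is the closure of $\{x:\sigma(x)\ne\iota_M(x)\}$, and the support of a section of $A(\mathcal G)$ is the closure of the set where it is non-zero. Let $\mathrm{Bis}_c^\infty(\mathcal G)$ be the group of compactly supported bisections, and let $\mathrm{Sect}_c(A(\mathcal G))$ be the Lie algebra of compactly supported smooth sections, with its usual locally convex inductive limit topology. For a subgroup $\Gamma\le\mathrm{Bis}_c^\infty(\mathcal G)$ let $I\Gamma$ be the set of isotopies in $\Gamma$ starting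 at $\iota_M$: smooth maps $\mathbb R\times M\to\mathcal G$, $(t,x)\mapsto\sigma_t(x)$, with $\sigma_t\in\Gamma$ for all $t$ and $\sigma_0=\iota_M$, such that for $t$ in any bounded interval the supports of the $\sigma_t$ lie in a common compact set. To such an isotopy one assigns the time-dependent section $$X_t(x)=(TR_{u})^{-1}\Big(\tfrac{\partial}{\partial s}\Big|_{s=t}\sigma_s(y)\Big),\qquad y=(\beta\circ\sigma_t)^{-1}(x),\quad u=\sigma_t(y),\tag{1}$$ where $R_u:\alpha^{-1}(x)\to\alpha^{-1}(y)$, $g\mapsto g\cdot u$. The group $\Gamma$ is called regular, with Lie algebra $\mathcal L(\Gamma)$, if $\mathcal L(\Gamma)$ is a closed Lie subalgebra of $\mathrm{Sect}_c(A(\mathcal G))$ and (1) defines a bijection between $I\Gamma$ and the space $I\mathcal L(\Gamma)$ of all smooth curves $\mathbb R\to\mathcal L(\Gamma)$. **Proposition 4.1.** Let $\Gamma\le\mathrm{Bis}_c^\infty(\mathcal G)$ be a regular subgroup with Lie algebra $\mathcal L(\Gamma)$. Suppose that for any open subsets $U,V\subset M$ with $\overline U\subset V$ and any $X\in I\mathcal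 L(\Gamma)$ there exists $Y\in I\mathcal L(\Gamma)$ such that $X_t=Y_t$ on $U$ and $\operatorname{supp}(Y_t)\subset V$ for all $t$. Then $\Gamma$ satisfies the (L)-condition: for all open, relatively compact sets $U,V\subset M$ with $\overline U\subset V$ there is a neighbourhood $\mathcal N$ of $\iota_M$ in the $C^1$ compact-open topology on the set of bisections such that for every isotopy $\sigma\in I\Gamma$ with $\sigma_t\in\mathcal N$ for all $t\in\mathbb R$ there is an isotopy $\tau\in I\Gamma$ with $\tau_t=\sigma_t$ on $U$ and $\operatorname{supp}(\tau_t)\subset V$ for all $t$. -/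

import Mathlib

open Set Filter Topology
open scoped Manifold ContDiff

/-- A Lie groupoid with arrow manifold `G` and manifold of units `M` (smooth, finite-dimensional,
without boundary, modelled on `EG` and `EM`).  The product `mul g h` is meaningful when
`src g = tgt h`; the laws and the smoothness of `mul` are required on the set of composable pairs
only.  The set of composable pairs is an embedded submanifold of `G × G`, and `ContMDiffOn` on it
is smoothness on that submanifold. -/
structure LieGroupoid (EM EG M G : Type*)
    [NormedAddCommGroup EM] [NormedSpace ℝ EM] [NormedAddCommGroup EG] [NormedSpace ℝ EG]
    [TopologicalSpace M] [ChartedSpace EM M] [TopologicalSpace G] [ChartedSpace EG G] where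
  src : G → M
  tgt : G → M
  unit : M → G
  inv : G → G
  mul : G → G → G
  src_unit : ∀ x, src (unit x) = x
  tgt_unit : ∀ x, tgt (unit x) = x
  src_inv : ∀ g, src (inv g) = tgt g
  tgt_inv : ∀ g, tgt (inv g) = src g
  src_mul : ∀ g h, src g = tgt h → src (mul g h) = src h
  tgt_mul : ∀ g h, src g = tgt h → tgt (mul g h) = tgt g
  mul_assoc : ∀ g h k, src g = tgt h → src h = tgt k → mul (mul g h) k = mul g (mul h k)
  unit_mul : ∀ g, mul (unit (tgt g)) g = g
  mul_unit : ∀ g, mul g (unit (src g)) = g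
  inv_mul : ∀ g, mul (inv g) g = unit (src g)
  mul_inv : ∀ g, mul g (inv g) = unit (tgt g)
  smooth_src : ContMDiff 𝓘(ℝ, EG) 𝓘(ℝ, EM) ∞ src
  smooth_tgt : ContMDiff 𝓘(ℝ, EG) 𝓘(ℝ, EM) ∞ tgt
  smooth_unit : ContMDiff 𝓘(ℝ, EM) 𝓘(ℝ, EG) ∞ unit
  smooth_inv : ContMDiff 𝓘(ℝ, EG) 𝓘(ℝ, EG) ∞ inv
  smooth_mul : ContMDiffOn (𝓘(ℝ, EG).prod 𝓘(ℝ, EG)) 𝓘(ℝ, EG) ∞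
    (fun p : G × G => mul p.1 p.2) {p | src p.1 = tgt p.2}
  /-- the source map is a submersion (hence so is `tgt = src ∘ inv`) -/
  submersion_src : ∀ g, Function.Surjective (mfderiv 𝓘(ℝ, EG) 𝓘(ℝ, EM) src g)

namespace LieGroupoid

section

variable {EM EG M G : Type*}
  [NormedAddCommGroup EM] [NormedSpace ℝ EM] [NormedAddCommGroup EG] [NormedSpace ℝ EG]
  [TopologicalSpace M] [ChartedSpace EM M] [TopologicalSpace G] [ChartedSpace EG G]

/-- A smooth bisection: a smooth section `σ` of the source map such that `tgt ∘ σ` is a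
diffeomorphism of `M`, recorded as `base`. -/
structure Bisection (𝒢 : LieGroupoid EM EG M G) where
  toFun : M → G
  smooth : ContMDiff 𝓘(ℝ, EM) 𝓘(ℝ, EG) ∞ toFun
  src_apply : ∀ x, 𝒢.src (toFun x) = x
  base : M ≃ₘ^∞⟮𝓘(ℝ, EM), 𝓘(ℝ, EM)⟯ M
  tgt_apply : ∀ x, 𝒢.tgt (toFun x) = base x

namespace Bisection

variable {𝒢 : LieGroupoid EM EG M G}

instance : CoeFun 𝒢.Bisection (fun _ => M → G) := ⟨toFun⟩

theorem ext {σ τ : 𝒢.Bisection} (h : ∀ x, σ x = τ x) : σ = τ := by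
  have hb : σ.base = τ.base := Diffeomorph.ext fun x => by
    rw [← σ.tgt_apply, ← τ.tgt_apply, h]
  obtain ⟨f, _, _, b, _⟩ := σ
  obtain ⟨f', _, _, b', _⟩ := τ
  obtain rfl : f = f' := funext h
  obtain rfl : b = b' := hb
  rfl

/-- The identity bisection: the inclusion of the units. -/
noncomputable instance : One 𝒢.Bisection where
  one :=
    { toFun := 𝒢.unit
      smooth := 𝒢.smooth_unit
      src_apply := 𝒢.src_unit
      base := Diffeomorph.refl _ _ _
      tgt_apply := 𝒢.tgt_unit }

/-- The product `(σ ⋆ τ)(x) = σ(tgt (τ x)) · τ x`. -/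
noncomputable instance : Mul 𝒢.Bisection where
  mul σ τ :=
    { toFun := fun x => 𝒢.mul (σ (τ.base x)) (τ x)
      smooth := by
        have h : ContMDiff 𝓘(ℝ, EM) (𝓘(ℝ, EG).prod 𝓘(ℝ, EG)) ∞
            (fun x => (σ (τ.base x), τ x)) :=
          (σ.smooth.comp τ.base.contMDiff).prodMk τ.smooth
        exact 𝒢.smooth_mul.comp_contMDiff h fun x => by
          simp [σ.src_apply, τ.tgt_apply]
      src_apply := fun x => by
        rw [𝒢.src_mul _ _ (by rw [σ.src_apply, τ.tgt_apply]), τ.src_apply]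
      base := τ.base.trans σ.base
      tgt_apply := fun x => by
        rw [𝒢.tgt_mul _ _ (by rw [σ.src_apply, τ.tgt_apply]), σ.tgt_apply]
        rfl }

/-- The inverse `σ⁻¹(x) = σ((tgt ∘ σ)⁻¹ x)⁻¹`. -/
noncomputable instance : Inv 𝒢.Bisection where
  inv σ :=
    { toFun := fun x => 𝒢.inv (σ (σ.base.symm x))
      smooth := 𝒢.smooth_inv.comp (σ.smooth.comp σ.base.symm.contMDiff)
      src_apply := fun x => by rw [𝒢.src_inv, σ.tgt_apply, σ.base.apply_symm_apply]
      base := σ.base.symm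
      tgt_apply := fun x => by rw [𝒢.tgt_inv, σ.src_apply] }

theorem one_apply (x : M) : (1 : 𝒢.Bisection) x = 𝒢.unit x := rfl

theorem mul_apply (σ τ : 𝒢.Bisection) (x : M) : (σ * τ) x = 𝒢.mul (σ (τ.base x)) (τ x) := rfl

theorem inv_apply (σ : 𝒢.Bisection) (x : M) : σ⁻¹ x = 𝒢.inv (σ (σ.base.symm x)) := rfl

/-- The group of all smooth bisections. -/
noncomputable instance : Group 𝒢.Bisection :=
  Group.ofLeftAxioms
    (fun σ τ ρ => ext fun x => by
      change 𝒢.mul (𝒢.mul (σ (τ.base (ρ.base x))) (τ (ρ.base x))) (ρ x) =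
        𝒢.mul (σ (τ.base (ρ.base x))) (𝒢.mul (τ (ρ.base x)) (ρ x))
      exact 𝒢.mul_assoc _ _ _ (by rw [σ.src_apply, τ.tgt_apply])
        (by rw [τ.src_apply, ρ.tgt_apply]))
    (fun σ => ext fun x => by
      change 𝒢.mul (𝒢.unit (σ.base x)) (σ x) = σ x
      rw [← σ.tgt_apply, 𝒢.unit_mul])
    (fun σ => ext fun x => by
      change 𝒢.mul (𝒢.inv (σ (σ.base.symm (σ.base x)))) (σ x) = 𝒢.unit x
      rw [σ.base.symm_apply_apply, 𝒢.inv_mul, σ.src_apply])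

theorem mul_inv_apply_symm (σ : 𝒢.Bisection) (x : M) :
    𝒢.mul (σ (σ.base.symm x)) (𝒢.inv (σ (σ.base.symm x))) = 𝒢.unit x := by
  rw [𝒢.mul_inv, σ.tgt_apply, σ.base.apply_symm_apply]

/-- The support of a bisection: the closure of the set where it differs from the units. -/
def support (σ : 𝒢.Bisection) : Set M := closure {x | σ x ≠ 𝒢.unit x}

variable [IsManifold 𝓘(ℝ, EM) ∞ M] [IsManifold 𝓘(ℝ, EG) ∞ G]

/-- The tangent map `TM → TG` of a bisection. -/
noncomputable def tangent (σ : 𝒢.Bisection) :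
    C(TangentBundle 𝓘(ℝ, EM) M, TangentBundle 𝓘(ℝ, EG) G) :=
  ⟨tangentMap 𝓘(ℝ, EM) 𝓘(ℝ, EG) σ.toFun, σ.smooth.continuous_tangentMap (by simp)⟩

/-- The `C¹` (compact-open) topology on bisections: the one induced by `σ ↦ Tσ` from the
compact-open topology on `C(TM, TG)`, i.e. uniform convergence of `σ` and its first derivatives on
compact sets. -/
noncomputable instance : TopologicalSpace 𝒢.Bisection :=
  TopologicalSpace.induced tangent ContinuousMap.compactOpen

end Bisection

/-! ### Sections of the Lie algebroid -/

section Algebroid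

variable [IsManifold 𝓘(ℝ, EM) ∞ M] [IsManifold 𝓘(ℝ, EG) ∞ G] (𝒢 : LieGroupoid EM EG M G)

/-- Arbitrary sections of `TG` along the units.  The Lie algebroid `A(𝒢)` is the bundle over `M`
with fibre `A_x = ker (T src) ⊆ T_{unit x} G`. -/
abbrev PreSection : Type _ := ∀ x : M, TangentSpace 𝓘(ℝ, EG) (𝒢.unit x)

/-- The space of compactly supported smooth sections of the Lie algebroid `A(𝒢)`. -/
def sectC : Submodule ℝ 𝒢.PreSection where
  carrier := {X |
    (∀ x, mfderiv 𝓘(ℝ, EG) 𝓘(ℝ, EM) 𝒢.src (𝒢.unit x) (X x) = 0) ∧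
    ContMDiff 𝓘(ℝ, EM) 𝓘(ℝ, EG).tangent ∞
      (fun x => (⟨𝒢.unit x, X x⟩ : TangentBundle 𝓘(ℝ, EG) G)) ∧
    IsCompact (closure {x | X x ≠ 0})}
  zero_mem' := by
    refine ⟨fun x => by simp, ?_, by simp⟩
    intro x
    refine (Bundle.contMDiffAt_totalSpace).2 ⟨𝒢.smooth_unit x, ?_⟩
    have hx : ∀ᶠ y in 𝓝 x, 𝒢.unit y ∈
        (trivializationAt EG (TangentSpace 𝓘(ℝ, EG)) (𝒢.unit x)).baseSet :=
      𝒢.smooth_unit.continuous.continuousAt.eventually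
        ((trivializationAt EG (TangentSpace 𝓘(ℝ, EG)) (𝒢.unit x)).open_baseSet.mem_nhds
          (FiberBundle.mem_baseSet_trivializationAt' _))
    refine (contMDiffAt_const (c := (0 : EG))).congr_of_eventuallyEq ?_
    filter_upwards [hx] with y hy
    exact ((trivializationAt EG (TangentSpace 𝓘(ℝ, EG)) (𝒢.unit x)).linear ℝ hy).map_zero
  add_mem' := by
    rintro X Y ⟨hX, sX, cX⟩ ⟨hY, sY, cY⟩
    refine ⟨fun x => ?_, ?_, ?_⟩
    · rw [Pi.add_apply, map_add, hX, hY, add_zero]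
    · intro x
      refine (Bundle.contMDiffAt_totalSpace).2 ⟨𝒢.smooth_unit x, ?_⟩
      have hx : ∀ᶠ y in 𝓝 x, 𝒢.unit y ∈
          (trivializationAt EG (TangentSpace 𝓘(ℝ, EG)) (𝒢.unit x)).baseSet :=
        𝒢.smooth_unit.continuous.continuousAt.eventually
          ((trivializationAt EG (TangentSpace 𝓘(ℝ, EG)) (𝒢.unit x)).open_baseSet.mem_nhds
            (FiberBundle.mem_baseSet_trivializationAt' _))
      refine (((Bundle.contMDiffAt_totalSpace).1 (sX x)).2.add
        ((Bundle.contMDiffAt_totalSpace).1 (sY x)).2).congr_of_eventuallyEq ?_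
      filter_upwards [hx] with y hy
      exact ((trivializationAt EG (TangentSpace 𝓘(ℝ, EG)) (𝒢.unit x)).linear ℝ hy).map_add _ _
    · refine (cX.union cY).of_isClosed_subset isClosed_closure ?_
      rw [← closure_union]
      refine closure_mono fun x hx => ?_
      by_contra h
      simp only [mem_union, mem_ofPred_eq, not_or, not_not] at h
      exact hx (by rw [Pi.add_apply, h.1, h.2, add_zero])
  smul_mem' := by
    rintro c X ⟨hX, sX, cX⟩
    refine ⟨fun x => ?_, ?_, ?_⟩
    · rw [Pi.smul_apply, map_smul, hX, smul_zero]
    · intro x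
      refine (Bundle.contMDiffAt_totalSpace).2 ⟨𝒢.smooth_unit x, ?_⟩
      have hx : ∀ᶠ y in 𝓝 x, 𝒢.unit y ∈
          (trivializationAt EG (TangentSpace 𝓘(ℝ, EG)) (𝒢.unit x)).baseSet :=
        𝒢.smooth_unit.continuous.continuousAt.eventually
          ((trivializationAt EG (TangentSpace 𝓘(ℝ, EG)) (𝒢.unit x)).open_baseSet.mem_nhds
            (FiberBundle.mem_baseSet_trivializationAt' _))
      refine ((contMDiffAt_const (I := 𝓘(ℝ, EM)) (I' := 𝓘(ℝ, ℝ)) (c := c)).smul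
        ((Bundle.contMDiffAt_totalSpace).1 (sX x)).2).congr_of_eventuallyEq ?_
      filter_upwards [hx] with y hy
      exact ((trivializationAt EG (TangentSpace 𝓘(ℝ, EG)) (𝒢.unit x)).linear ℝ hy).map_smul _ _
    · refine cX.of_isClosed_subset isClosed_closure (closure_mono fun x hx h => ?_)
      exact hx (by rw [Pi.smul_apply, h, smul_zero])

variable {𝒢}

/-- The support of a section of the Lie algebroid. -/
def secSupport (X : 𝒢.sectC) : Set M := closure {x | X.val x ≠ 0}

/-- The section `X` read in the preferred chart of `M` at `x₀` and in the trivialization of `TG`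
at `unit x₀`. -/
noncomputable def localRep (x₀ : M) (X : 𝒢.sectC) (z : EM) : EG :=
  (trivializationAt EG (TangentSpace 𝓘(ℝ, EG)) (𝒢.unit x₀)
    ⟨𝒢.unit ((chartAt EM x₀).symm z), X.val ((chartAt EM x₀).symm z)⟩).2

variable (𝒢)

/-- The open subset of `EM` on which `localRep x₀` is the local representation. -/
def localDomain (x₀ : M) : Set EM :=
  {z | z ∈ (chartAt EM x₀).target ∧
    𝒢.unit ((chartAt EM x₀).symm z) ∈ (chartAt EG (𝒢.unit x₀)).source}

/-- The `C^∞` compact-open topology on sections: uniform convergence on compact sets of all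
derivatives of all local representations. -/
@[reducible]
noncomputable def smoothTopology : TopologicalSpace 𝒢.sectC :=
  ⨅ (x₀ : M) (k : ℕ), TopologicalSpace.induced
    (fun X => UniformOnFun.ofFun {C : Set EM | IsCompact C ∧ C ⊆ 𝒢.localDomain x₀}
      (iteratedFDeriv ℝ k (localRep x₀ X)))
    (UniformOnFun.topologicalSpace EM (EM [×k]→L[ℝ] EG)
      {C : Set EM | IsCompact C ∧ C ⊆ 𝒢.localDomain x₀})

/-- The inductive limit topology on compactly supported sections: the finest locally convex vector
space topology for which, for every compact `K`, the inclusion of the space of sections supported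
in `K`, with its `C^∞` topology, is continuous. -/
@[reducible]
noncomputable def lfTopology : TopologicalSpace 𝒢.sectC :=
  sInf {t : TopologicalSpace 𝒢.sectC |
    @IsTopologicalAddGroup 𝒢.sectC t _ ∧ @ContinuousSMul ℝ 𝒢.sectC _ _ t ∧
    @LocallyConvexSpace ℝ 𝒢.sectC _ _ _ _ t ∧
    ∀ K : Set M, IsCompact K →
      @Continuous {X : 𝒢.sectC // secSupport X ⊆ K} 𝒢.sectC
        (TopologicalSpace.induced Subtype.val 𝒢.smoothTopology) t Subtype.val}

variable {𝒢}

/-- A smooth curve in the locally convex space of compactly supported sections: all iterated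
derivatives exist, as limits of difference quotients. -/
def IsSmoothCurve (X : ℝ → 𝒢.sectC) : Prop :=
  ∃ D : ℕ → ℝ → 𝒢.sectC, D 0 = X ∧
    ∀ (k : ℕ) (t : ℝ), Tendsto (fun h : ℝ => h⁻¹ • (D k (t + h) - D k t)) (𝓝[≠] 0)
      (@nhds 𝒢.sectC 𝒢.lfTopology (D (k + 1) t))

/-- The space of smooth curves `ℝ → L`, for a (closed) subspace `L` of sections. -/
def curves (L : Submodule ℝ 𝒢.sectC) : Set (ℝ → 𝒢.sectC) :=
  {X | IsSmoothCurve X ∧ ∀ t, X t ∈ L}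

variable (𝒢)

/-- The differential at `g`, applied to `v ∈ ker (T src)_g`, of the right translation `h ↦ h · u`,
defined on the source fibre `{h | src h = tgt u}` through `g`.  As `v` is tangent to that fibre, the
value does not depend on the choice of a derivative within it. -/
noncomputable def rightTranslate (u g : G) (v : TangentSpace 𝓘(ℝ, EG) g) :
    TangentSpace 𝓘(ℝ, EG) (𝒢.mul g u) :=
  mfderivWithin 𝓘(ℝ, EG) 𝓘(ℝ, EG) (fun h => 𝒢.mul h u) {h | 𝒢.src h = 𝒢.tgt u} g v

variable {𝒢}

/-- The right-invariant vector field on `G` determined by a section `X` of `A(𝒢)`: at `g` it is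
the right translate by `g` of `X (tgt g)`.  (It lives over `unit (tgt g) · g = g`; this equality of
points is the transport.) -/
noncomputable def rightInvariant (X : 𝒢.sectC) (g : G) : TangentSpace 𝓘(ℝ, EG) g :=
  (𝒢.unit_mul g) ▸ 𝒢.rightTranslate g (𝒢.unit (𝒢.tgt g)) (X.val (𝒢.tgt g))

/-- The Lie algebroid bracket of two sections: the value along the units of the bracket of the
associated right-invariant vector fields. -/
noncomputable def bracket (X Y : 𝒢.sectC) : 𝒢.PreSection := fun x =>
  VectorField.mlieBracket 𝓘(ℝ, EG) (rightInvariant X) (rightInvariant Y) (𝒢.unit x)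

/-- The (right) logarithmic derivative of a time-dependent bisection.  With
`y = (tgt ∘ σ_t)⁻¹ x` and `u = σ_t y`, it is the vector of `A_x` obtained from the velocity
`∂σ_s(y)/∂s|_{s=t}` by pulling back along the right translation by `u`, i.e. by pushing forward
along the right translation by `u⁻¹`. -/
noncomputable def logDeriv (σ : ℝ → 𝒢.Bisection) (t : ℝ) : 𝒢.PreSection := fun x =>
  (σ t).mul_inv_apply_symm x ▸
    𝒢.rightTranslate (𝒢.inv (σ t ((σ t).base.symm x))) (σ t ((σ t).base.symm x))
      (mfderiv 𝓘(ℝ, ℝ) 𝓘(ℝ, EG) (fun s => σ s ((σ t).base.symm x)) t (1 : ℝ))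

end Algebroid

/-! ### Isotopies, regularity, locality -/

section Groups

variable {𝒢 : LieGroupoid EM EG M G}

/-- The set `IΓ` of isotopies in a group `Γ` of compactly supported bisections starting at the
identity: smooth maps `(t, x) ↦ σ_t(x)` with `σ_t ∈ Γ` and `σ_0 = 1`, where for `t` in a bounded
interval the supports stay in a common compact set (smooth curves in the group of compactly
supported bisections). -/
def isotopies (Γ : Subgroup 𝒢.Bisection) : Set (ℝ → 𝒢.Bisection) :=
  {σ | ContMDiff (𝓘(ℝ, ℝ).prod 𝓘(ℝ, EM)) 𝓘(ℝ, EG) ∞ (fun p : ℝ × M => σ p.1 p.2) ∧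
    (∀ t, σ t ∈ Γ) ∧ σ 0 = 1 ∧
    ∀ T : ℝ, ∃ K : Set M, IsCompact K ∧ ∀ t ∈ Icc (-T) T, (σ t).support ⊆ K}

variable [IsManifold 𝓘(ℝ, EM) ∞ M] [IsManifold 𝓘(ℝ, EG) ∞ G]

/-- `Γ` is a regular group of compactly supported bisections with Lie algebra `L`: `L` is a closed
Lie subalgebra of the compactly supported sections of `A(𝒢)`, and the evolution operator, the
inverse of the logarithmic derivative, is a bijection from the smooth curves in `L` onto the
isotopies in `Γ`. -/
structure IsRegular (Γ : Subgroup 𝒢.Bisection) (L : Submodule ℝ 𝒢.sectC) : Prop where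
  compact_support : ∀ σ ∈ Γ, IsCompact σ.support
  isClosed : @IsClosed 𝒢.sectC 𝒢.lfTopology (L : Set 𝒢.sectC)
  bracket_mem : ∀ X ∈ L, ∀ Y ∈ L, ∃ Z ∈ L, (Z : 𝒢.PreSection) = bracket X Y
  evolution : BijOn logDeriv (isotopies Γ)
    ((fun (X : ℝ → 𝒢.sectC) (t : ℝ) => (X t : 𝒢.PreSection)) '' curves L)

/-- Time-dependent sections in `L` can be localized. -/
def IsLocalizable (L : Submodule ℝ 𝒢.sectC) : Prop :=
  ∀ U V : Set M, IsOpen U → IsOpen V → closure U ⊆ V → ∀ X ∈ curves L,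
    ∃ Y ∈ curves L, (∀ t, ∀ x ∈ U, (X t).val x = (Y t).val x) ∧ ∀ t, secSupport (Y t) ⊆ V

/-- The (L)-condition (locality), for groups of compactly supported smooth bisections: for open
relatively compact `U`, `V` with `closure U ⊆ V` there is a `C¹` neighbourhood `N` of the identity
such that every isotopy in `Γ` with all `σ_t ∈ N` agrees on `U` with an isotopy in `Γ` supported
in `V`. -/
def LCondition (Γ : Subgroup 𝒢.Bisection) : Prop :=
  ∀ U V : Set M, IsOpen U → IsOpen V → IsCompact (closure U) → IsCompact (closure V) →
    closure U ⊆ V →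
    ∃ N ∈ 𝓝 (1 : 𝒢.Bisection), ∀ σ ∈ isotopies Γ, (∀ t, σ t ∈ N) →
      ∃ τ ∈ isotopies Γ, (∀ t, ∀ x ∈ U, τ t x = σ t x) ∧ ∀ t, (τ t).support ⊆ V

end Groups

end

end LieGroupoid

/-! Choose open sets with `closure U ⊆ W`, `closure W ⊆ V'` and `closure V' ⊆ V`, and let the
neighbourhood consist of the bisections whose base map sends `closure U` into `W`. Let `X` be the
logarithmic derivative of `σ`, let `Y` agree with `X` on `W` and have support in `V'`, and let `τ`
be the isotopy in `Γ` that regularity attaches to `Y`. For `x ∈ U` the trajectory `(σ t).base x`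
never leaves `W`, so `σ` and `τ` have the same logarithmic derivative along it, and this forces `τ t
x = σ t x`. For `x ∉ V'` the same argument compares `τ` with the constant isotopy `1`, whose
trajectory through `x` is `x` itself, where `Y` vanishes.

What carries the proof is a pointwise uniqueness statement, `eq_of_logDeriv_eq`, which needs equal
logarithmic derivatives only along one trajectory. Applying `T tgt` gives an equation for the base
trajectories, settled by `eq_of_hasVelocityAt_family`: an isotopy of diffeomorphisms straightens its
own trajectories, so a curve with the same velocities becomes constant. Once the base trajectories
agree, the quotient `τ_s(x)⁻¹ · σ_s(x)` is defined, and `hasVelocityAt_inv_mul_zero` shows that its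
velocity vanishes; it therefore keeps its initial value, a unit. -/

/-! ### Local uniqueness of trajectories in a vector space. -/

/-- A curve whose velocity at each time is that of the member of the family `t ↦ f (t, y)` through
the same point stays, near an intersection time, on one member of the family. -/
theorem eventually_eq_of_hasDerivAt_family {E : Type*} [NormedAddCommGroup E] [NormedSpace ℝ E]
    [CompleteSpace E] {f : ℝ × E → E} {c : ℝ → E} {t₀ : ℝ} {x₀ : E}
    (hf : ContDiffAt ℝ 1 f (t₀, x₀)) (A : E ≃L[ℝ] E)
    (hA : HasFDerivAt (fun z => f (t₀, z)) (A : E →L[ℝ] E) x₀)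
    (hc : ContinuousAt c t₀) (h₀ : c t₀ = f (t₀, x₀))
    (hv : ∀ᶠ p in 𝓝 (t₀, x₀), f p = c p.1 →
      ∃ w, HasDerivAt c w p.1 ∧ HasDerivAt (fun s => f (s, p.2)) w p.1) :
    ∀ᶠ t in 𝓝 t₀, c t = f (t, x₀) := by
  set F : ℝ × E → ℝ × E := fun p => (p.1, f p) with hF
  have hFc : ContDiffAt ℝ 1 F (t₀, x₀) := contDiffAt_fst.prodMk hf
  have hdf : HasFDerivAt f (fderiv ℝ f (t₀, x₀)) (t₀, x₀) :=
    (hf.differentiableAt (by simp)).hasFDerivAt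
  set D := fderiv ℝ f (t₀, x₀)
  have hDA : ∀ v, D (0, v) = A v := fun v => by
    have h1 : HasFDerivAt (fun z : E => ((t₀, z) : ℝ × E)) (ContinuousLinearMap.inr ℝ ℝ E) x₀ :=
      hasFDerivAt_prodMk_right t₀ x₀
    have h2 := HasFDerivAt.comp (g := f) x₀ hdf h1
    have h3 := h2.unique hA
    simpa using congrArg (fun T : E →L[ℝ] E => T v) h3
  -- The derivative of `(t, z) ↦ (t, f (t, z))` is block triangular with diagonal blocks `1` and
  -- `A`, hence invertible; the inverse function theorem then straightens the family.
  let F' : (ℝ × E) ≃L[ℝ] (ℝ × E) := (ContinuousLinearEquiv.refl ℝ ℝ).skewProd A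
    (D.comp (ContinuousLinearMap.inl ℝ ℝ E))
  have hF' : HasFDerivAt F (F' : ℝ × E →L[ℝ] ℝ × E) (t₀, x₀) := by
    convert! hasFDerivAt_fst.prodMk hdf using 1
    refine ContinuousLinearMap.ext fun p => ?_
    change (p.1, A p.2 + D (p.1, 0)) = (p.1, D p)
    rw [← hDA, ← map_add]
    simp
  set e := hFc.toOpenPartialHomeomorph F hF' (by simp)
  have hr : ∀ p ∈ e.target, F (e.symm p) = p := fun p hp => e.right_inv hp
  have hF₀ : F (t₀, x₀) = (t₀, c t₀) := by simp [hF, h₀]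
  have hes : (t₀, x₀) ∈ e.source := hFc.mem_toOpenPartialHomeomorph_source hF' (by simp)
  have het : (t₀, c t₀) ∈ e.target := by
    have := hFc.image_mem_toOpenPartialHomeomorph_target hF' (by simp)
    rwa [hF₀] at this
  have hinv : e.symm (t₀, c t₀) = (t₀, x₀) := by
    rw [h₀]; exact e.left_inv hes
  have hsymm : ContDiffAt ℝ 1 e.symm (t₀, c t₀) := by
    have := hFc.to_localInverse hF' (by simp)
    rwa [hF₀] at this
  have hgr : ContinuousAt (fun t => (t, c t)) t₀ := continuousAt_id.prodMk hc
  have hy : ContinuousAt (fun t => e.symm (t, c t)) t₀ :=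
    ContinuousAt.comp (g := e.symm) hsymm.continuousAt hgr
  have hy' : Tendsto (fun t => e.symm (t, c t)) (𝓝 t₀) (𝓝 (t₀, x₀)) := by
    rw [← hinv]; exact hy
  have hev : ∀ᶠ t in 𝓝 t₀, (t, c t) ∈ e.target ∧
      HasDerivAt (fun t => (e.symm (t, c t)).2) 0 t := by
    filter_upwards [hgr.eventually (e.open_target.mem_nhds het), hy'.eventually hv,
      hgr.eventually (hsymm.eventually (by simp))] with t h1 h2 h3
    refine ⟨h1, ?_⟩
    obtain ⟨y, hyt⟩ : ∃ y, e.symm (t, c t) = (t, y) := by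
      refine ⟨(e.symm (t, c t)).2, Prod.ext ?_ rfl⟩
      exact (congrArg Prod.fst (hr _ h1) :)
    have hys : (t, y) ∈ e.source := hyt ▸ e.map_target h1
    have hfy : f (t, y) = c t := by
      have := congrArg Prod.snd (hr _ h1)
      rwa [hyt] at this
    rw [hyt] at h2
    obtain ⟨w, hw1, hw2⟩ := h2 hfy
    have hD := (h3.differentiableAt (by simp)).hasFDerivAt
    have k1 : HasDerivAt (fun t => e.symm (t, c t)) _ t :=
      hD.comp_hasDerivAt t ((hasDerivAt_id t).prodMk hw1)
    -- The family member through `c t` has the velocity `w` of `c`, so its straightened image has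
    -- the same derivative at `t` as that of `c`. That image is `s ↦ (s, y)`, with derivative `(1,
    -- 0)`.
    have k2 : HasDerivAt (fun s => e.symm (s, f (s, y))) (fderiv ℝ e.symm (t, c t) (1, w)) t :=
      HasFDerivAt.comp_hasDerivAt (l := e.symm) (f := fun s => (s, f (s, y))) t
        (by rw [hfy]; exact hD) ((hasDerivAt_id t).prodMk hw2)
    have k3 : HasDerivAt (fun s => e.symm (s, f (s, y))) ((1 : ℝ), (0 : E)) t := by
      refine ((hasDerivAt_id t).prodMk (hasDerivAt_const t y)).congr_of_eventuallyEq ?_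
      have : ContinuousAt (fun s : ℝ => (s, y)) t := by fun_prop
      filter_upwards [this.eventually (e.open_source.mem_nhds hys)] with s hs
      exact e.left_inv hs
    rw [k2.unique k3] at k1
    exact (hasFDerivAt_snd (p := e.symm (t, c t))).comp_hasDerivAt t k1
  obtain ⟨ε, hε, hball⟩ := Metric.eventually_nhds_iff_ball.1 hev
  filter_upwards [Metric.ball_mem_nhds t₀ hε] with t ht
  have hconst : (e.symm (t, c t)).2 = (e.symm (t₀, c t₀)).2 :=
    Metric.isOpen_ball.is_const_of_deriv_eq_zero (convex_ball t₀ ε).isPreconnected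
      (fun s hs => (hball s hs).2.differentiableAt.differentiableWithinAt)
      (fun s hs => (hball s hs).2.deriv) ht (Metric.mem_ball_self hε)
  rw [hinv] at hconst
  have h1 := hr _ (hball t ht).1
  have h2 : e.symm (t, c t) = (t, x₀) := Prod.ext (congrArg Prod.fst h1 :) hconst
  rw [h2] at h1
  exact (congrArg Prod.snd h1).symm

/-! ### Velocities of curves and uniqueness of trajectories on manifolds. -/

section Velocity

variable {E M F N : Type*} [NormedAddCommGroup E] [NormedSpace ℝ E] [NormedAddCommGroup F]
  [NormedSpace ℝ F] [TopologicalSpace M] [ChartedSpace E M] [TopologicalSpace N] [ChartedSpace F N]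

/-- The curve `c` has velocity `v` at time `t`, read in the preferred chart at `c t`. -/
def HasVelocityAt (c : ℝ → M) (v : E) (t : ℝ) : Prop :=
  HasMFDerivAt 𝓘(ℝ, ℝ) 𝓘(ℝ, E) c t (ContinuousLinearMap.toSpanSingleton ℝ v : ℝ →L[ℝ] E)

theorem hasVelocityAt_const (x : M) (t : ℝ) : HasVelocityAt (fun _ : ℝ => x) (0 : E) t := by
  have h := hasMFDerivAt_const (I := 𝓘(ℝ, ℝ)) (I' := 𝓘(ℝ, E)) x t
  unfold HasVelocityAt
  rw [ContinuousLinearMap.toSpanSingleton_zero]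
  exact h

theorem HasVelocityAt.hasDerivAt {c : ℝ → E} {v : E} {t : ℝ} (h : HasVelocityAt c v t) :
    HasDerivAt c v t :=
  hasDerivAt_iff_hasFDerivAt.2 (hasMFDerivAt_iff_hasFDerivAt.1 h)

theorem MDifferentiableAt.hasVelocityAt {c : ℝ → M} {t : ℝ}
    (h : MDifferentiableAt 𝓘(ℝ, ℝ) 𝓘(ℝ, E) c t) :
    HasVelocityAt (E := E) c (mfderiv 𝓘(ℝ, ℝ) 𝓘(ℝ, E) c t (1 : ℝ)) t := by
  unfold HasVelocityAt
  have h₁ : ∀ T : ℝ →L[ℝ] E, ContinuousLinearMap.toSpanSingleton ℝ (T 1) = T := fun T => by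
    ext; simp
  exact (h₁ _).symm ▸ h.hasMFDerivAt

theorem HasVelocityAt.unique {c : ℝ → M} {v w : E} {t : ℝ} (hv : HasVelocityAt c v t)
    (hw : HasVelocityAt c w t) : v = w := by
  have h := hasMFDerivAt_unique hv hw
  have := congrArg (fun T : ℝ →L[ℝ] E => T 1) h
  simpa only [ContinuousLinearMap.toSpanSingleton_apply, one_smul] using this

/-- Chain rule along a curve that stays in a set. -/
theorem HasMFDerivWithinAt.hasVelocityAt_comp {f : M → N} {s : Set M} {p : M} {D : E →L[ℝ] F}
    (hf : HasMFDerivWithinAt 𝓘(ℝ, E) 𝓘(ℝ, F) f s p D) {c : ℝ → M} {v : E} {t : ℝ}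
    (hc : HasVelocityAt c v t) (hp : c t = p) (hs : ∀ r, c r ∈ s) :
    HasVelocityAt (fun r => f (c r)) (D v) t := by
  subst hp
  have h := hf.comp t (hasMFDerivWithinAt_univ.2 hc) (fun r _ => hs r)
  rw [hasMFDerivWithinAt_univ] at h
  unfold HasVelocityAt
  have h₁ : ContinuousLinearMap.toSpanSingleton ℝ (D v) =
      D.comp (ContinuousLinearMap.toSpanSingleton ℝ v) := by ext; simp
  rw [h₁]
  exact h

/-- The point is the order of quantifiers: a single `D` serves all curves through `p`, so curves
with a common velocity there have images with a common velocity. -/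
theorem MDifferentiableAt.exists_hasVelocityAt_comp {f : M → N} {p : M}
    (hf : MDifferentiableAt 𝓘(ℝ, E) 𝓘(ℝ, F) f p) :
    ∃ D : E →L[ℝ] F, ∀ (c : ℝ → M) (v : E) (t : ℝ), HasVelocityAt c v t → c t = p →
      HasVelocityAt (fun r => f (c r)) (D v) t :=
  ⟨mfderiv 𝓘(ℝ, E) 𝓘(ℝ, F) f p, fun _ _ _ hc hp =>
    HasMFDerivWithinAt.hasVelocityAt_comp (hasMFDerivWithinAt_univ.2 hf.hasMFDerivAt) hc hp
      fun _ => mem_univ _⟩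

variable [CompleteSpace E] [IsManifold 𝓘(ℝ, E) ∞ M]

/-- The vector space case, read in the preferred charts at `x` and `φ t₀ x`. -/
theorem eventually_eq_of_hasVelocityAt_family (φ : ℝ → M ≃ₘ^∞⟮𝓘(ℝ, E), 𝓘(ℝ, E)⟯ M)
    (hφ : ContMDiff (𝓘(ℝ, ℝ).prod 𝓘(ℝ, E)) 𝓘(ℝ, E) ∞ (fun p : ℝ × M => φ p.1 p.2))
    {c : ℝ → M} (hc : Continuous c) {x : M} {t₀ : ℝ} (h₀ : c t₀ = φ t₀ x)
    (hv : ∀ t y, φ t y = c t →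
      ∃ v : E, HasVelocityAt c v t ∧ HasVelocityAt (fun s => φ s y) v t) :
    ∀ᶠ t in 𝓝 t₀, c t = φ t x := by
  set ψ := extChartAt 𝓘(ℝ, E) (φ t₀ x)
  set χ := extChartAt 𝓘(ℝ, E) x
  set f : ℝ × E → E := fun p => ψ (φ p.1 (χ.symm p.2)) with hfdef
  have hf : ContDiffAt ℝ 1 f (t₀, χ x) := by
    have h := (contMDiffAt_iff.1 (hφ (t₀, x))).2
    have h' : ContDiffAt ℝ ∞ f (t₀, χ x) := by
      rw [ModelWithCorners.range_eq_univ, contDiffWithinAt_univ, extChartAt_prod] at h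
      exact h
    exact h'.of_le (by simp)
  -- The spatial derivative is invertible because `φ t₀` is a diffeomorphism.
  let A : E ≃L[ℝ] E := (φ t₀).mfderivToContinuousLinearEquiv (by simp) x
  have hA : HasFDerivAt (fun z => f (t₀, z)) (A : E →L[ℝ] E) (χ x) := by
    have h := (((φ t₀).contMDiff.mdifferentiable (by simp)) x).hasMFDerivAt.2
    rw [ModelWithCorners.range_eq_univ] at h
    exact HasFDerivWithinAt.hasFDerivAt_of_univ h
  have hxχ : χ.symm (χ x) = x := extChartAt_to_inv x
  have hψ₀ : φ t₀ x ∈ ψ.source := mem_extChartAt_source _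
  have hψo : IsOpen ψ.source := isOpen_extChartAt_source _
  have hcs : ∀ᶠ t in 𝓝 t₀, c t ∈ ψ.source :=
    hc.continuousAt.eventually (hψo.mem_nhds (h₀ ▸ hψ₀))
  have hχc : ContinuousAt χ.symm (χ x) := continuousAt_extChartAt_symm x
  have hφc : ContinuousAt (fun p : ℝ × E => φ p.1 (χ.symm p.2)) (t₀, χ x) := by
    refine ContinuousAt.comp (g := fun p : ℝ × M => φ p.1 p.2)
      (f := fun p : ℝ × E => (p.1, χ.symm p.2)) hφ.continuous.continuousAt ?_
    exact continuousAt_fst.prodMk (ContinuousAt.comp (x := (t₀, χ x)) hχc continuousAt_snd)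
  have hfs : ∀ᶠ p : ℝ × E in 𝓝 (t₀, χ x), φ p.1 (χ.symm p.2) ∈ ψ.source :=
    hφc.eventually (hψo.mem_nhds (by simpa [hxχ] using hψ₀))
  have hev : ∀ᶠ t in 𝓝 t₀, (fun t => ψ (c t)) t = f (t, χ x) := by
    refine eventually_eq_of_hasDerivAt_family hf A hA ?_ ?_ ?_
    · exact ContinuousAt.comp (g := ψ) (h₀ ▸ continuousAt_extChartAt _) hc.continuousAt
    · simp [hfdef, hxχ, h₀]
    · filter_upwards [hfs, continuousAt_fst.eventually hcs] with p hp hcp hfp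
      have heq : φ p.1 (χ.symm p.2) = c p.1 := ψ.injOn hp hcp hfp
      obtain ⟨v, hv1, hv2⟩ := hv _ _ heq
      have hψd : MDifferentiableAt 𝓘(ℝ, E) 𝓘(ℝ, E) ψ (c p.1) :=
        (contMDiffAt_extChartAt' (by simpa [ψ, extChartAt_source] using hcp)).mdifferentiableAt
          (n := ∞) (by simp)
      obtain ⟨D, hD⟩ := hψd.exists_hasVelocityAt_comp
      exact ⟨D v, (hD _ _ _ hv1 rfl).hasDerivAt, (hD _ _ _ hv2 heq).hasDerivAt⟩
  have hfs' : ∀ᶠ t in 𝓝 t₀, φ t x ∈ ψ.source := by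
    have : ContinuousAt (fun t => φ t x) t₀ :=
      (hφ.continuous.comp (continuous_id.prodMk continuous_const)).continuousAt
    exact this.eventually (hψo.mem_nhds hψ₀)
  filter_upwards [hev, hcs, hfs'] with t h1 h2 h3
  exact ψ.injOn h2 h3 (by simpa [hfdef, hxχ] using h1)

/-- A curve with the velocity of a smooth isotopy `φ` of diffeomorphisms is a trajectory
of `φ`. -/
theorem eq_of_hasVelocityAt_family [T2Space M] (φ : ℝ → M ≃ₘ^∞⟮𝓘(ℝ, E), 𝓘(ℝ, E)⟯ M)
    (hφ : ContMDiff (𝓘(ℝ, ℝ).prod 𝓘(ℝ, E)) 𝓘(ℝ, E) ∞ (fun p : ℝ × M => φ p.1 p.2))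
    {c : ℝ → M} (hc : Continuous c) {x : M} {t₀ : ℝ} (h₀ : c t₀ = φ t₀ x)
    (hv : ∀ t y, φ t y = c t →
      ∃ v : E, HasVelocityAt c v t ∧ HasVelocityAt (fun s => φ s y) v t) (t : ℝ) :
    c t = φ t x := by
  have hclosed : IsClosed {t | c t = φ t x} :=
    isClosed_eq hc (hφ.continuous.comp (continuous_id.prodMk continuous_const))
  have hopen : IsOpen {t | c t = φ t x} := isOpen_iff_mem_nhds.2 fun s hs =>
    eventually_eq_of_hasVelocityAt_family φ hφ hc hs hv
  have := IsClopen.eq_univ ⟨hclosed, hopen⟩ ⟨t₀, h₀⟩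
  exact this.ge (mem_univ t)

/-- The constant isotopy at the identity has constant trajectories, all of velocity zero. -/
theorem eq_of_hasVelocityAt_zero [T2Space M] {c : ℝ → M}
    (hc : ∀ t, HasVelocityAt c (0 : E) t) (s t : ℝ) : c t = c s :=
  eq_of_hasVelocityAt_family (fun _ => Diffeomorph.refl _ _ _) contMDiff_snd
    (continuous_iff_continuousAt.2 fun t => (hc t).1) (t₀ := s) rfl
    (fun t y _ => ⟨0, hc t, hasVelocityAt_const y t⟩) t

end Velocity

/-- Chain rule for a function of two curves with the same velocity. -/
theorem HasMFDerivWithinAt.hasVelocityAt_comp_pair {E M F N : Type*} [NormedAddCommGroup E]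
    [NormedSpace ℝ E] [NormedAddCommGroup F] [NormedSpace ℝ F] [TopologicalSpace M]
    [ChartedSpace E M] [TopologicalSpace N] [ChartedSpace F N]
    {n : M × M → N} {S : Set (M × M)} {q : M × M} {D : E × E →L[ℝ] F}
    (hn : HasMFDerivWithinAt (𝓘(ℝ, E).prod 𝓘(ℝ, E)) 𝓘(ℝ, F) n S q D) {u v : ℝ → M} {w : E} {t : ℝ}
    (hu : HasVelocityAt u w t) (hv : HasVelocityAt v w t) (hq : (u t, v t) = q)
    (hS : ∀ r, (u r, v r) ∈ S) : HasVelocityAt (fun r => n (u r, v r)) (D (w, w)) t := by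
  subst hq
  have h := HasMFDerivWithinAt.comp t hn (hasMFDerivWithinAt_univ.2 (HasMFDerivAt.prodMk hu hv))
    (fun r _ => hS r)
  rw [hasMFDerivWithinAt_univ] at h
  unfold HasVelocityAt
  have h₁ : ContinuousLinearMap.toSpanSingleton ℝ (D (w, w)) =
      D.comp ((ContinuousLinearMap.toSpanSingleton ℝ w).prod
        (ContinuousLinearMap.toSpanSingleton ℝ w)) := by ext; simp
  rw [h₁]
  exact h

/-! ### Groupoid calculus and uniqueness for the logarithmic derivative. -/

namespace LieGroupoid

variable {EM EG M G : Type*}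
  [NormedAddCommGroup EM] [NormedSpace ℝ EM] [NormedAddCommGroup EG] [NormedSpace ℝ EG]
  [TopologicalSpace M] [ChartedSpace EM M] [TopologicalSpace G] [ChartedSpace EG G]
  {𝒢 : LieGroupoid EM EG M G}

theorem contMDiffOn_inv_mul (𝒢 : LieGroupoid EM EG M G) :
    ContMDiffOn (𝓘(ℝ, EG).prod 𝓘(ℝ, EG)) 𝓘(ℝ, EG) ∞
      (fun p : G × G => 𝒢.mul (𝒢.inv p.1) p.2) {p | 𝒢.tgt p.1 = 𝒢.tgt p.2} :=
  𝒢.smooth_mul.comp (t := {p : G × G | 𝒢.src p.1 = 𝒢.tgt p.2})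
    ((𝒢.smooth_inv.comp contMDiff_fst).prodMk contMDiff_snd).contMDiffOn
    (fun p hp => (𝒢.src_inv p.1).trans hp)

theorem contMDiffOn_mul_right (𝒢 : LieGroupoid EM EG M G) (u : G) :
    ContMDiffOn 𝓘(ℝ, EG) 𝓘(ℝ, EG) ∞ (fun h => 𝒢.mul h u) {h | 𝒢.src h = 𝒢.tgt u} :=
  𝒢.smooth_mul.comp (t := {p : G × G | 𝒢.src p.1 = 𝒢.tgt p.2})
    (contMDiff_id.prodMk contMDiff_const).contMDiffOn (fun _ hp => hp)

theorem contMDiffOn_mul_left (𝒢 : LieGroupoid EM EG M G) (u : G) :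
    ContMDiffOn 𝓘(ℝ, EG) 𝓘(ℝ, EG) ∞ (fun h => 𝒢.mul u h) {h | 𝒢.src u = 𝒢.tgt h} :=
  𝒢.smooth_mul.comp (t := {p : G × G | 𝒢.src p.1 = 𝒢.tgt p.2})
    (contMDiff_const.prodMk contMDiff_id).contMDiffOn (fun _ hp => hp)

theorem mul_inv_mul_cancel (𝒢 : LieGroupoid EM EG M G) {g a : G} (h : 𝒢.src g = 𝒢.src a) :
    𝒢.mul (𝒢.mul g (𝒢.inv a)) a = g := by
  rw [𝒢.mul_assoc _ _ _ (by rw [𝒢.tgt_inv, h]) (𝒢.src_inv a), 𝒢.inv_mul, ← h, 𝒢.mul_unit]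

theorem mul_inv_mul_cancel_left (𝒢 : LieGroupoid EM EG M G) {g b : G} (h : 𝒢.tgt g = 𝒢.tgt b) :
    𝒢.mul b (𝒢.mul (𝒢.inv b) g) = g := by
  rw [← 𝒢.mul_assoc _ _ _ (𝒢.tgt_inv b).symm (by rw [𝒢.src_inv, h]), 𝒢.mul_inv, ← h, 𝒢.unit_mul]

theorem inv_mul_inv (𝒢 : LieGroupoid EM EG M G) {g h : G} (hgh : 𝒢.src g = 𝒢.tgt h) :
    𝒢.mul (𝒢.inv h) (𝒢.inv g) = 𝒢.inv (𝒢.mul g h) := by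
  have h1 : 𝒢.src (𝒢.inv h) = 𝒢.tgt (𝒢.inv g) := by rw [𝒢.src_inv, 𝒢.tgt_inv, hgh]
  have h2 : 𝒢.src (𝒢.mul (𝒢.inv h) (𝒢.inv g)) = 𝒢.tgt (𝒢.mul g h) := by
    rw [𝒢.src_mul _ _ h1, 𝒢.src_inv, 𝒢.tgt_mul _ _ hgh]
  have h3 : 𝒢.mul (𝒢.mul (𝒢.inv h) (𝒢.inv g)) (𝒢.mul g h) = 𝒢.unit (𝒢.src h) := by
    rw [𝒢.mul_assoc _ _ _ h1 (by rw [𝒢.src_inv, 𝒢.tgt_mul _ _ hgh]),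
      ← 𝒢.mul_assoc _ _ _ (𝒢.src_inv g) hgh, 𝒢.inv_mul, hgh, 𝒢.unit_mul, 𝒢.inv_mul]
  rw [← 𝒢.mul_unit (𝒢.mul (𝒢.inv h) (𝒢.inv g)), h2, ← 𝒢.mul_inv (𝒢.mul g h),
    ← 𝒢.mul_assoc _ _ _ h2 (𝒢.tgt_inv _).symm, h3, ← 𝒢.src_mul _ _ hgh, ← 𝒢.tgt_inv,
    𝒢.unit_mul]

/-- Two curves in a source fibre with the same targets whose right translates to the units have the
same velocity at `t` have a quotient with vanishing velocity at `t`. -/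
theorem hasVelocityAt_inv_mul_zero (𝒢 : LieGroupoid EM EG M G) {a b : ℝ → G} {x : M} {t : ℝ}
    {w : EG} (ha : ∀ s, 𝒢.src (a s) = x) (hb : ∀ s, 𝒢.src (b s) = x)
    (hab : ∀ s, 𝒢.tgt (b s) = 𝒢.tgt (a s))
    (hva : HasVelocityAt (fun s => 𝒢.mul (a s) (𝒢.inv (a t))) w t)
    (hvb : HasVelocityAt (fun s => 𝒢.mul (b s) (𝒢.inv (b t))) w t) :
    HasVelocityAt (fun s => 𝒢.mul (𝒢.inv (b s)) (a s)) (0 : EG) t := by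
  set u := fun s => 𝒢.mul (a s) (𝒢.inv (a t)) with hu
  set v := fun s => 𝒢.mul (b s) (𝒢.inv (b t)) with hv
  set p := 𝒢.tgt (a t) with hp
  have sa : ∀ s, 𝒢.src (a s) = 𝒢.tgt (𝒢.inv (a t)) := fun s => by rw [𝒢.tgt_inv, ha, ha]
  have sb : ∀ s, 𝒢.src (b s) = 𝒢.tgt (𝒢.inv (b t)) := fun s => by rw [𝒢.tgt_inv, hb, hb]
  have su : ∀ s, 𝒢.src (u s) = p := fun s => by rw [hu, 𝒢.src_mul _ _ (sa s), 𝒢.src_inv]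
  have sv : ∀ s, 𝒢.src (v s) = p := fun s => by
    rw [hv, 𝒢.src_mul _ _ (sb s), 𝒢.src_inv, hab]
  have huv : ∀ s, 𝒢.tgt (v s) = 𝒢.tgt (u s) := fun s => by
    rw [hv, hu, 𝒢.tgt_mul _ _ (sb s), 𝒢.tgt_mul _ _ (sa s), hab]
  have ut : u t = 𝒢.unit p := 𝒢.mul_inv _
  have vt : v t = 𝒢.unit p := by rw [hv, hp, ← hab]; exact 𝒢.mul_inv _
  set S : Set (G × G) := {q | 𝒢.src q.1 = p ∧ 𝒢.src q.2 = p ∧ 𝒢.tgt q.1 = 𝒢.tgt q.2}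
  -- Chosen so that `n (v s, u s)` is the quotient `(b s)⁻¹ · a s`, while `n` is constant along the
  -- diagonal curve `(u s, u s)`.
  set n : G × G → G := fun q =>
    𝒢.mul (𝒢.mul (𝒢.inv (b t)) (𝒢.mul (𝒢.inv q.1) q.2)) (a t)
  have htn : ∀ q ∈ S, 𝒢.src (𝒢.inv (b t)) = 𝒢.tgt (𝒢.mul (𝒢.inv q.1) q.2) := fun q hq => by
    rw [𝒢.src_inv, 𝒢.tgt_mul _ _ ((𝒢.src_inv _).trans hq.2.2), 𝒢.tgt_inv, hq.1, hab]
  have hsn : ∀ q ∈ S,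
      𝒢.src (𝒢.mul (𝒢.inv (b t)) (𝒢.mul (𝒢.inv q.1) q.2)) = 𝒢.tgt (a t) := fun q hq => by
    rw [𝒢.src_mul _ _ (htn q hq), 𝒢.src_mul _ _ ((𝒢.src_inv _).trans hq.2.2), hq.2.1]
  have hns : ContMDiffOn (𝓘(ℝ, EG).prod 𝓘(ℝ, EG)) 𝓘(ℝ, EG) ∞ n S :=
    (𝒢.contMDiffOn_mul_right (a t)).comp
      ((𝒢.contMDiffOn_mul_left (𝒢.inv (b t))).comp
        (𝒢.contMDiffOn_inv_mul.mono fun q hq => hq.2.2) htn) hsn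
  have hSp : (𝒢.unit p, 𝒢.unit p) ∈ S := ⟨𝒢.src_unit p, 𝒢.src_unit p, rfl⟩
  obtain ⟨D, hD⟩ : ∃ D : EG × EG →L[ℝ] EG, HasMFDerivWithinAt (𝓘(ℝ, EG).prod 𝓘(ℝ, EG)) 𝓘(ℝ, EG)
      n S (𝒢.unit p, 𝒢.unit p) D :=
    ⟨_, ((hns _ hSp).mdifferentiableWithinAt (by simp)).hasMFDerivWithinAt⟩
  have h1 := hD.hasVelocityAt_comp_pair hvb hva (Prod.ext vt ut) fun s => ⟨sv s, su s, huv s⟩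
  -- Both pairs of curves pass through the same point with velocity `(w, w)`. The diagonal pair
  -- shows `D (w, w) = 0` without any computation of `D`.
  have h2 := hD.hasVelocityAt_comp_pair hva hva (Prod.ext ut ut) fun s => ⟨su s, su s, rfl⟩
  have e1 : (fun s => n (v s, u s)) = fun s => 𝒢.mul (𝒢.inv (b s)) (a s) := by
    funext s
    have hbv : 𝒢.mul (v s) (b t) = b s := 𝒢.mul_inv_mul_cancel (by rw [hb, hb])
    have hau : 𝒢.mul (u s) (a t) = a s := 𝒢.mul_inv_mul_cancel (by rw [ha, ha])
    have hvb' : 𝒢.src (v s) = 𝒢.tgt (b t) := by rw [sv, hab]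
    have hbt : 𝒢.mul (𝒢.inv (b t)) (𝒢.inv (v s)) = 𝒢.inv (b s) := by
      rw [𝒢.inv_mul_inv hvb', hbv]
    have h3 : 𝒢.src (𝒢.inv (v s)) = 𝒢.tgt (u s) := by rw [𝒢.src_inv, huv]
    change 𝒢.mul (𝒢.mul (𝒢.inv (b t)) (𝒢.mul (𝒢.inv (v s)) (u s))) (a t) = _
    rw [← 𝒢.mul_assoc _ _ _ (by rw [𝒢.src_inv, 𝒢.tgt_inv, hvb']) h3, hbt,
      𝒢.mul_assoc _ _ _ (by rw [𝒢.src_inv, ← huv, ← hbv, 𝒢.tgt_mul _ _ hvb']) (su s), hau]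
  have e2 : (fun s => n (u s, u s)) = fun _ => 𝒢.mul (𝒢.inv (b t)) (a t) := by
    funext s
    change 𝒢.mul (𝒢.mul (𝒢.inv (b t)) (𝒢.mul (𝒢.inv (u s)) (u s))) (a t) = _
    rw [𝒢.inv_mul, su, hp, ← hab, ← 𝒢.src_inv, 𝒢.mul_unit]
  rw [e1] at h1
  rw [e2] at h2
  rwa [h2.unique (hasVelocityAt_const _ t)] at h1

/-- The logarithmic derivative is the velocity of the isotopy translated back to the units. -/
theorem hasVelocityAt_mul_inv {σ : ℝ → 𝒢.Bisection}
    (hσ : ContMDiff (𝓘(ℝ, ℝ).prod 𝓘(ℝ, EM)) 𝓘(ℝ, EG) ∞ (fun p : ℝ × M => σ p.1 p.2))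
    (t : ℝ) {y x : M} (hy : y = (σ t).base.symm x) :
    HasVelocityAt (E := EG) (fun s => 𝒢.mul (σ s y) (𝒢.inv (σ t y))) (logDeriv σ t x) t := by
  subst hy
  set y := (σ t).base.symm x with hy
  -- Every tangent space is the model space `EG`, so the transport in `logDeriv` does not change the
  -- underlying vector.
  have hcast : ∀ (g g' : G) (h : g = g') (v : TangentSpace 𝓘(ℝ, EG) g),
      ((h ▸ v : TangentSpace 𝓘(ℝ, EG) g') : EG) = (v : EG) := by
    rintro g _ rfl v; rfl
  have hlog := hcast _ _ ((σ t).mul_inv_apply_symm x)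
    (𝒢.rightTranslate (𝒢.inv (σ t y)) (σ t y) (mfderiv 𝓘(ℝ, ℝ) 𝓘(ℝ, EG) (fun s => σ s y) t (1 : ℝ)))
  have hs : ContMDiff 𝓘(ℝ, ℝ) 𝓘(ℝ, EG) ∞ (fun s => σ s y) :=
    hσ.comp (contMDiff_id.prodMk contMDiff_const)
  have hv := ((hs t).mdifferentiableAt (by simp)).hasVelocityAt
  have hmem : ∀ r, σ r y ∈ {h | 𝒢.src h = 𝒢.tgt (𝒢.inv (σ t y))} := fun r => by
    simp [(σ r).src_apply, (σ t).src_apply, 𝒢.tgt_inv]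
  have hR := ((𝒢.contMDiffOn_mul_right (𝒢.inv (σ t y)) (σ t y)
    (hmem t)).mdifferentiableWithinAt (by simp)).hasMFDerivWithinAt
  have := HasMFDerivWithinAt.hasVelocityAt_comp hR hv rfl hmem
  unfold logDeriv
  exact hlog.symm ▸ this

theorem logDeriv_one (t : ℝ) (x : M) : logDeriv (fun _ => (1 : 𝒢.Bisection)) t x = 0 :=
  (hasVelocityAt_mul_inv (σ := fun _ => (1 : 𝒢.Bisection)) (𝒢.smooth_unit.comp contMDiff_snd) t
    rfl).unique (hasVelocityAt_const _ t)

variable [IsManifold 𝓘(ℝ, EM) ∞ M] [IsManifold 𝓘(ℝ, EG) ∞ G]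

/-- Isotopies with the same logarithmic derivative along a trajectory of the first agree on it. -/
theorem eq_of_logDeriv_eq [CompleteSpace EM] [CompleteSpace EG] [T2Space M] [T2Space G]
    {σ τ : ℝ → 𝒢.Bisection}
    (hσ : ContMDiff (𝓘(ℝ, ℝ).prod 𝓘(ℝ, EM)) 𝓘(ℝ, EG) ∞ (fun p : ℝ × M => σ p.1 p.2))
    (hτ : ContMDiff (𝓘(ℝ, ℝ).prod 𝓘(ℝ, EM)) 𝓘(ℝ, EG) ∞ (fun p : ℝ × M => τ p.1 p.2))
    (h₀ : σ 0 = τ 0) {x : M}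
    (h : ∀ t, logDeriv σ t ((σ t).base x) = logDeriv τ t ((σ t).base x)) (t : ℝ) :
    σ t x = τ t x := by
  have hvel : ∀ (ρ : ℝ → 𝒢.Bisection), ContMDiff (𝓘(ℝ, ℝ).prod 𝓘(ℝ, EM)) 𝓘(ℝ, EG) ∞
      (fun p : ℝ × M => ρ p.1 p.2) → ∀ t y, HasVelocityAt (E := EG)
        (fun s => 𝒢.mul (ρ s y) (𝒢.inv (ρ t y))) (logDeriv ρ t ((ρ t).base y)) t :=
    fun ρ hρ t y => hasVelocityAt_mul_inv hρ t ((ρ t).base.symm_apply_apply y).symm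
  have htgt : ∀ (ρ : ℝ → 𝒢.Bisection) (t : ℝ) (y : M),
      (fun s => 𝒢.tgt (𝒢.mul (ρ s y) (𝒢.inv (ρ t y)))) = fun s => (ρ s).base y :=
    fun ρ t y => funext fun s => by
      rw [𝒢.tgt_mul _ _ (by rw [𝒢.tgt_inv, (ρ s).src_apply, (ρ t).src_apply]), (ρ s).tgt_apply]
  have hbase : ∀ t, (σ t).base x = (τ t).base x := by
    have hc : Continuous fun t => (σ t).base x := by
      have := (𝒢.smooth_tgt.continuous.comp hσ.continuous).comp
        (continuous_id.prodMk (continuous_const (y := x)))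
      simpa [Function.comp_def, Bisection.tgt_apply] using this
    have hφ : ContMDiff (𝓘(ℝ, ℝ).prod 𝓘(ℝ, EM)) 𝓘(ℝ, EM) ∞
        (fun p : ℝ × M => (τ p.1).base p.2) := by
      simpa [Function.comp_def, Bisection.tgt_apply] using 𝒢.smooth_tgt.comp hτ
    refine eq_of_hasVelocityAt_family (fun t => (τ t).base) hφ hc (t₀ := 0) (by rw [h₀]) ?_
    intro t y hy
    have h1 := hvel σ hσ t x
    have h2 := hvel τ hτ t y
    rw [hy, ← h t] at h2
    -- The two translated curves pass through the same unit with the same velocity. Right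
    -- translation does not change targets, so `tgt` maps them to the base trajectories.
    obtain ⟨D, hD⟩ := ((𝒢.smooth_tgt (𝒢.unit ((σ t).base x))).mdifferentiableAt
      (by simp)).exists_hasVelocityAt_comp
    have h3 := hD _ _ _ h1 (by rw [𝒢.mul_inv, (σ t).tgt_apply])
    have h4 := hD _ _ _ h2 (by rw [𝒢.mul_inv, (τ t).tgt_apply]; exact congrArg _ hy)
    rw [htgt] at h3 h4
    exact ⟨_, h3, h4⟩
  have hk : ∀ t, HasVelocityAt (fun s => 𝒢.mul (𝒢.inv (τ s x)) (σ s x)) (0 : EG) t := fun t => by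
    have h2 := hvel τ hτ t x
    rw [← hbase t, ← h t] at h2
    exact 𝒢.hasVelocityAt_inv_mul_zero (fun s => (σ s).src_apply x) (fun s => (τ s).src_apply x)
      (fun s => by rw [(τ s).tgt_apply, (σ s).tgt_apply, hbase]) (hvel σ hσ t x) h2
  have hk0 := eq_of_hasVelocityAt_zero hk 0 t
  simp only [h₀, 𝒢.inv_mul] at hk0
  rw [(τ 0).src_apply] at hk0
  have h5 : 𝒢.tgt (σ t x) = 𝒢.tgt (τ t x) := by rw [(τ t).tgt_apply, (σ t).tgt_apply, hbase]
  have h6 := 𝒢.mul_unit (τ t x)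
  rw [(τ t).src_apply] at h6
  rw [← 𝒢.mul_inv_mul_cancel_left h5, hk0, h6]

/-- Bisections whose base map sends a compact set into an open neighbourhood of it form a
neighbourhood of the identity. -/
theorem mapsTo_base_mem_nhds_one {K W : Set M} (hK : IsCompact K) (hW : IsOpen W) (hKW : K ⊆ W) :
    {σ : 𝒢.Bisection | MapsTo σ.base K W} ∈ 𝓝 (1 : 𝒢.Bisection) := by
  rw [nhds_induced]
  -- Only the `C⁰` part of the topology is needed: evaluating tangent maps on zero vectors over `K`
  -- recovers the bisection on `K`.
  have hz : Continuous (fun x : M => (⟨x, 0⟩ : TangentBundle 𝓘(ℝ, EM) M)) :=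
    (Bundle.contMDiff_zeroSection ℝ (TangentSpace 𝓘(ℝ, EM) : M → Type _)
      (IB := 𝓘(ℝ, EM)) (F := EM) (n := 0)).continuous
  have hp : Continuous (fun v : TangentBundle 𝓘(ℝ, EG) G => 𝒢.tgt v.proj) :=
    𝒢.smooth_tgt.continuous.comp (FiberBundle.continuous_proj EG (TangentSpace 𝓘(ℝ, EG)))
  have hT : ∀ (σ : 𝒢.Bisection) (x : M), 𝒢.tgt (σ.tangent ⟨x, 0⟩).proj = σ.base x :=
    fun σ x => σ.tgt_apply x
  refine ⟨_, ContinuousMap.eventually_mapsTo (f := (1 : 𝒢.Bisection).tangent) (hK.image hz)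
    (hW.preimage hp) ?_, ?_⟩
  · rintro _ ⟨x, hx, rfl⟩
    rw [mem_preimage, hT]
    exact hKW hx
  · intro σ hσ x hx
    have := hσ (mem_image_of_mem _ hx)
    rwa [mem_preimage, hT] at this

end LieGroupoid

/-! ### Localization of isotopies. -/

theorem proposition4p1 {EM EG M G : Type*}
    [NormedAddCommGroup EM] [NormedSpace ℝ EM] [FiniteDimensional ℝ EM]
    [NormedAddCommGroup EG] [NormedSpace ℝ EG] [FiniteDimensional ℝ EG]
    [TopologicalSpace M] [ChartedSpace EM M] [IsManifold 𝓘(ℝ, EM) ∞ M]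
    [T2Space M] [SecondCountableTopology M]
    [TopologicalSpace G] [ChartedSpace EG G] [IsManifold 𝓘(ℝ, EG) ∞ G] [T2Space G]
    (𝒢 : LieGroupoid EM EG M G)
    (Γ : Subgroup 𝒢.Bisection) (L : Submodule ℝ 𝒢.sectC)
    (hΓ : LieGroupoid.IsRegular Γ L) (hL : LieGroupoid.IsLocalizable L) :
    LieGroupoid.LCondition Γ := by
  have : CompleteSpace EM := FiniteDimensional.complete ℝ EM
  have : CompleteSpace EG := FiniteDimensional.complete ℝ EG
  have : LocallyCompactSpace M := ChartedSpace.locallyCompactSpace EM M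
  intro U V _ hV hUc _ hUV
  obtain ⟨W, hWo, hUW, hWV, hWc⟩ := exists_open_between_and_isCompact_closure hUc hV hUV
  -- The extra set `V'` absorbs a closure: `τ` is shown to be trivial off `V'`, which puts its
  -- support only in `closure V'`.
  obtain ⟨V', hVo, hWV', hVV, _⟩ := exists_open_between_and_isCompact_closure hWc hV hWV
  refine ⟨_, LieGroupoid.mapsTo_base_mem_nhds_one hUc hWo hUW, fun σ hσ hσN => ?_⟩
  obtain ⟨X, hX, hXσ⟩ := hΓ.evolution.mapsTo hσ
  obtain ⟨Y, hY, hXY, hYV⟩ := hL W V' hWo hVo hWV' X hX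
  obtain ⟨τ, hτ, hτY⟩ := hΓ.evolution.surjOn ⟨Y, hY, rfl⟩
  refine ⟨τ, hτ, fun t x hx => ?_, fun t => ?_⟩
  · refine (LieGroupoid.eq_of_logDeriv_eq hσ.1 hτ.1 (hσ.2.2.1.trans hτ.2.2.1.symm)
      (fun s => ?_) t).symm
    rw [← hXσ, hτY]
    -- The neighbourhood condition holds at every time, so the whole trajectory of `x` stays in `W`,
    -- where `X` and `Y` agree.
    exact hXY s _ (hσN s (subset_closure hx))
  · refine (closure_mono fun x hx => ?_).trans hVV
    by_contra hxV
    -- With the constant isotopy as first argument, the logarithmic derivative of `τ` has to vanish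
    -- only at `x` itself.
    refine hx (LieGroupoid.eq_of_logDeriv_eq (σ := fun _ => 1) (𝒢.smooth_unit.comp contMDiff_snd)
      hτ.1 hτ.2.2.1.symm (fun s => ?_) t).symm
    rw [LieGroupoid.logDeriv_one, hτY]
    by_contra hne
    exact hxV (hYV s (subset_closure (Ne.symm hne)))
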